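/- **Theorem 1.8.** Let $t,\ell\ge 0$ be integers, let $\alpha=(\alpha_1,\dots,\alpha_\ell)$, $\beta=(\beta_1,\dots,\beta_\ell)$ and $y$ be families of indeterminates, let $b_n\in\mathbb R[y]$ $(n\ge0)$ be polynomials with nonnegative coefficients, and let $a_n^{(i)}$ $(n\ge 0,\ 0\le i\le \ell)$ be given by $$\sum_{i=0}^{\ell}a_n^{(i)}z^i=\prod_{j=1}^{\ell}(\alpha_jz+\beta_j)\qquad\text{for all } n\ge 0,$$ so that $a_n^{(i)}$ does not depend on $n$. Consider lattice paths in $\mathbb N^2$ with steps $(0,1)$ and $(1,t+i)$, $0\le i\le\ell$, where a step $(0,1)$ from height $n-1$ to height $n$ has weight $b_n$ and a step $(1,t+i)$ from height $n-t-i$ to height $n$ has weight $a_n^{(i)}$; the weight of a path is the product of the weights of its steps. Let $M=[M_{n,k}]_{n,k\ge0}$, where $M_{n,k}$ is the sum of the weights of all such paths from $(0,0)$ to $(k,n)$. A matrix over a real polynomial ring is called totally positive in the indeterminates if all its finite minors (rows and columns taken in increasing order) are polynomials with nonnegative coefficients. The Toeplitz matrix of a sequence $(s_i)_{i\ge0}$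 is $[s_{i-j}]_{i,j\ge0}$ with $s_m=0$ for $m<0$. For formal power series $g,f$, the Riordan array $\mathcal R(g,f)$ is the matrix with $(n,k)$ entry $[z^n]\,g(z)f(z)^k$. Then: 1. $M$ is totally positive in $(\alpha,\beta,y)$; if $t\ge1$, then for every $n\ge0$ the Toeplitz matrix of the row $(M_{n,k})_{k\ge0}$ is also totally positive in $(\alpha,\beta,y)$. Suppose moreover that $b_n=\gamma$ for all $n\ge0$, where $\gamma\in\mathbb R[y]$ (for instance, $\gamma$ is itself the only indeterminate in $y$, so that $(\alpha,\beta,y)$ below reads $(\alpha,\beta,\gamma)$). Then: 2. for every $k\ge0$, the Toeplitz matrix of the column $(M_{n,k})_{n\ge0}$ is totally positive in $(\alpha,\beta,y)$; 3. if $t\ge1$, then for all integers $0\le k\le n$, $\delta>0$ and $\sigma>\max\{k,\delta\}$, the Toeplitz matrix of the sequence $(M_{n+\delta i,\,k+\sigma i})_{i\ge0}$ is totally positive in $(\alpha,\beta,y)$; 4. writing $a_i$ for the common value of the $a_n^{(i)}$, $$M=\mathcal R\left(\frac1{1-\gamma z},\ \frac{\sum_{i=0}^{\ell}a_iz^{t+i}}{1-\gamma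 z}\right);$$ 5. for all $n,k\ge0$, $$M_{n,k}=\sum_{\substack{i\ge0,\ 0\le c_1,\dots,c_\ell\le k\\ i+c_1+\cdots+c_\ell=n-tk}}\binom{k+i}{i}\gamma^i\prod_{j=1}^{\ell}\binom{k}{c_j}\alpha_j^{c_j}\beta_j^{k-c_j};$$ 6. as formal power series in $q$ and $z$, $$\sum_{n\ge0}\sum_{k\ge0}M_{n,k}\,q^kz^n=\frac{1}{1-\gamma z-q\sum_{i=0}^{\ell}a_iz^{t+i}}.$$ -/

import Mathlib

/-- A step of a lattice path: `up` is the step `(0, 1)`, and `diag i` is the step `(1, t + i)`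
with `0 ≤ i ≤ ℓ` (the parameter `t` enters in `LatticeStep.dx`, `LatticeStep.dy`). -/
inductive LatticeStep (ℓ : ℕ) : Type
  | up : LatticeStep ℓ
  | diag (i : Fin (ℓ + 1)) : LatticeStep ℓ

namespace LatticeStep

/-- Horizontal displacement of a step. -/
def dx {ℓ : ℕ} : LatticeStep ℓ → ℕ
  | up => 0
  | diag _ => 1

/-- Vertical displacement of a step. -/
def dy (t : ℕ) {ℓ : ℕ} : LatticeStep ℓ → ℕ
  | up => 1
  | diag i => t + i

/-- The weight of a step which arrives at height `h`: `b h` for a step `(0, 1)` (from height `h - 1`)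
and `a h i` for a step `(1, t + i)` (from height `h - t - i`). -/
def weight {R : Type*} {ℓ : ℕ} (a : ℕ → Fin (ℓ + 1) → R) (b : ℕ → R) (h : ℕ) : LatticeStep ℓ → R
  | up => b h
  | diag i => a h i

instance finite (ℓ : ℕ) : Finite (LatticeStep ℓ) := by
  refine Finite.of_injective
    (fun s : LatticeStep ℓ => match s with
      | up => (none : Option (Fin (ℓ + 1)))
      | diag i => some i) ?_
  intro s s' h
  cases s <;> cases s' <;> simp_all

end LatticeStep

/-- Abscissa of the end point of the path starting at `(0, 0)` with the given steps.
A path is the list of its steps, written from the last step to the first one. -/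
def pathX {ℓ : ℕ} : List (LatticeStep ℓ) → ℕ
  | [] => 0
  | s :: p => pathX p + s.dx

/-- Height (ordinate) of the end point of the path starting at `(0, 0)` with the given steps
(last step first). -/
def pathY (t : ℕ) {ℓ : ℕ} : List (LatticeStep ℓ) → ℕ
  | [] => 0
  | s :: p => pathY t p + s.dy t

/-- The weight of a path (last step first): the product of the weights of its steps, each step being
weighted according to the height at which it arrives. -/
def pathWeight {R : Type*} [CommRing R] (t : ℕ) {ℓ : ℕ} (a : ℕ → Fin (ℓ + 1) → R) (b : ℕ → R) :
    List (LatticeStep ℓ) → R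
  | [] => 1
  | s :: p => pathWeight t a b p * s.weight a b (pathY t (s :: p))

/-- The set of all lattice paths from `(0, 0)` to `(k, n)` with steps `(0, 1)` and `(1, t + i)`,
`0 ≤ i ≤ ℓ`. -/
def latticePaths (t ℓ n k : ℕ) : Set (List (LatticeStep ℓ)) :=
  {p | pathX p = k ∧ pathY t p = n}

theorem length_le_pathX_add_pathY (t : ℕ) {ℓ : ℕ} (p : List (LatticeStep ℓ)) :
    p.length ≤ pathX p + pathY t p := by
  induction p with
  | nil => simp
  | cons s p ih =>
    cases s <;> simp only [List.length_cons, pathX, pathY, LatticeStep.dx, LatticeStep.dy] <;> omega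

theorem latticePaths_finite (t ℓ n k : ℕ) : (latticePaths t ℓ n k).Finite := by
  refine (List.finite_length_le (LatticeStep ℓ) (k + n)).subset ?_
  rintro p ⟨hx, hy⟩
  have h := length_le_pathX_add_pathY t p
  rw [hx, hy] at h
  exact h

/-- The matrix `M`: the entry `M n k` is the sum of the weights of all lattice paths from `(0, 0)`
to `(k, n)`. -/
noncomputable def pathMatrix {R : Type*} [CommRing R] (t ℓ : ℕ) (a : ℕ → Fin (ℓ + 1) → R)
    (b : ℕ → R) : Matrix ℕ ℕ R :=
  Matrix.of fun n k => ∑ p ∈ (latticePaths_finite t ℓ n k).toFinset, pathWeight t a b p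

/-- A polynomial with nonnegative coefficients in the indeterminates indexed by `σ`. -/
def NonnegCoeffs {σ : Type*} (p : MvPolynomial σ ℝ) : Prop :=
  ∀ m : σ →₀ ℕ, 0 ≤ p.coeff m

/-- A matrix of polynomials is totally positive in the indeterminates (indexed by `σ`) if all its
(finite) minors are polynomials with nonnegative coefficients. -/
def TotallyPositive {σ : Type*} (A : Matrix ℕ ℕ (MvPolynomial σ ℝ)) : Prop :=
  ∀ (m : ℕ) (I J : Fin m → ℕ), StrictMono I → StrictMono J → NonnegCoeffs (A.submatrix I J).det

/-- The Toeplitz matrix `[s (i - j)]` of a sequence `s`, with `s m = 0` for negative `m`. -/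
def toeplitz {R : Type*} [Zero R] (s : ℕ → R) : Matrix ℕ ℕ R :=
  Matrix.of fun i j => if j ≤ i then s (i - j) else 0

/-- The Riordan array of `g` and `f`: its `k`-th column has generating function `g * f ^ k`. -/
noncomputable def riordan {R : Type*} [CommRing R] (g f : PowerSeries R) : Matrix ℕ ℕ R :=
  Matrix.of fun n k => PowerSeries.coeff n (g * f ^ k)

/-- The bivariate generating function `∑ A n k q ^ k z ^ n` of a matrix, as a formal power series
in the two variables `q = X 0` and `z = X 1`. -/
def bivariateGF {R : Type*} (A : Matrix ℕ ℕ R) : MvPowerSeries (Fin 2) R :=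
  fun e => A (e 1) (e 0)

/-- The polynomials over `ℝ` in the indeterminates `α₁, …, α_ℓ`, `β₁, …, β_ℓ` and `y` (the latter
indexed by `Y`). -/
abbrev WeightRing (ℓ : ℕ) (Y : Type*) : Type _ := MvPolynomial ((Fin ℓ ⊕ Fin ℓ) ⊕ Y) ℝ

/-- The indeterminate `α j`. -/
noncomputable def alphaVar {ℓ : ℕ} (Y : Type*) (j : Fin ℓ) : WeightRing ℓ Y :=
  MvPolynomial.X (Sum.inl (Sum.inl j))

/-- The indeterminate `β j`. -/
noncomputable def betaVar {ℓ : ℕ} (Y : Type*) (j : Fin ℓ) : WeightRing ℓ Y :=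
  MvPolynomial.X (Sum.inl (Sum.inr j))

/-- A polynomial in the indeterminates `y`, regarded as a polynomial in `α`, `β`, `y`. -/
noncomputable def yPoly (ℓ : ℕ) {Y : Type*} (p : MvPolynomial Y ℝ) : WeightRing ℓ Y :=
  MvPolynomial.rename Sum.inr p

/-! Cutting a path at its last step `(1, t + i)` gives the matrix equation `M = L [e₀ | H M]`. Here
`L` carries the weights of vertical runs, `H` is the Toeplitz matrix of the series `∑ a_i z^(t +
i)`, and `e₀` is the first unit column, which accounts for paths without such a step. Both `L` and
`H` are lower triangular and totally positive: `L` is a limit of products of bidiagonal matrices,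
and `H` is a product of Toeplitz matrices of `z` and of the factors `α_j z + β_j`. Since column `k +
1` of `M` depends only on column `k`, Cauchy–Binet and induction on the number of columns give total
positivity of `M` (`totallyPositive_of_eq_lowerMul_consCol`).

For the rows, `L` and `H` are modified above height `n` so that the solution of the same equation
contains the reversed Toeplitz matrix of row `n` (`totallyPositive_toeplitz_row`).

For constant `b = γ`, `L` is the Toeplitz matrix of `g = 1 / (1 - γ z)`, and the equation says that
column `k` has generating function `g (s g)^k`, where `s` is the step series. The column, Riordan
and binomial statements follow; the sequences along lines are rows of another Riordan array of the
same kind; the bivariate series comes from the last-step recurrence. -/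

/-! ### Determinant identities. -/

namespace Matrix

/-- The Cauchy–Binet formula. -/
theorem det_mul_eq_sum_powersetCard {R ι : Type*} [CommRing R] [Fintype ι] [LinearOrder ι] {m : ℕ}
    (A : Matrix (Fin m) ι R) (B : Matrix ι (Fin m) R) :
    (A * B).det = ∑ S : Finset.powersetCard m (Finset.univ : Finset ι),
      (A.submatrix id ((S : Finset ι).orderEmbOfFin (Finset.mem_powersetCard.1 S.2).2)).det *
      (B.submatrix ((S : Finset ι).orderEmbOfFin (Finset.mem_powersetCard.1 S.2).2) id).det := by
  classical
  -- Each row of `A * B` is a combination of rows of `B`; multilinearity gives a sum over all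
  -- choices `r` of rows, and repeated rows contribute zero.
  have h1 : (A * B).det = ∑ r : Fin m → ι, (∏ i, A i (r i)) * (B.submatrix r id).det := by
    have h : A * B = fun i => ∑ k, A i k • B k := by
      ext i j
      simp [Matrix.mul_apply, Finset.sum_apply]
    have h' := (detRowAlternating (n := Fin m) (R := R)).toMultilinearMap.map_sum
      (fun i (k : ι) => A i k • B k)
    rw [h]
    refine h'.trans (Finset.sum_congr rfl fun r _ => ?_)
    exact (MultilinearMap.map_smul_univ _ (fun i => A i (r i)) (fun i => B (r i)))
  have h2 : (A * B).det = ∑ r : Fin m → ι with Function.Injective r,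
      (∏ i, A i (r i)) * (B.submatrix r id).det := by
    rw [h1, Finset.sum_filter_of_ne]
    intro r _ hr
    by_contra hinj
    simp only [Function.Injective, not_forall] at hinj
    obtain ⟨i, j, hij, hne⟩ := hinj
    refine hr ?_
    rw [det_zero_of_row_eq hne, mul_zero]
    ext k
    simp [hij]
  -- An injective `r` is the increasing enumeration of its image followed by a permutation; the
  -- signed sum over permutations is the minor of `A`.
  rw [h2, ← Finset.sum_fiberwise_of_maps_to (t := Finset.powersetCard m Finset.univ)
    (g := fun r : Fin m → ι => Finset.univ.image r), ← Finset.sum_coe_sort]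
  · refine Finset.sum_congr rfl fun S _ => ?_
    obtain ⟨S, hS⟩ := S
    have hc := (Finset.mem_powersetCard.1 hS).2
    set g := S.orderEmbOfFin hc with hg
    have key : ∑ σ : Equiv.Perm (Fin m), (∏ i, A i (g (σ i))) * (B.submatrix (g ∘ σ) id).det =
        (A.submatrix id g).det * (B.submatrix g id).det := by
      rw [← det_transpose (A.submatrix id g), det_apply', Finset.sum_mul]
      refine Finset.sum_congr rfl fun σ _ => ?_
      have := det_permute σ (B.submatrix g id)
      rw [submatrix_submatrix] at this
      simp only [Function.comp_id] at this
      rw [this]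
      simp only [transpose_apply, submatrix_apply, id]
      ring
    simp only
    rw [← key]
    symm
    refine Finset.sum_bij (fun σ _ => g ∘ σ) ?_ ?_ ?_ ?_
    · intro σ _
      simp only [Finset.mem_filter, Finset.mem_univ, true_and]
      refine ⟨g.injective.comp σ.injective, ?_⟩
      ext x
      have : x ∈ S ↔ x ∈ Set.range g := by rw [hg, Finset.range_orderEmbOfFin]; rfl
      rw [this]
      simp only [Finset.mem_image, Finset.mem_univ, true_and, Function.comp_apply, Set.mem_range]
      exact ⟨fun ⟨a, ha⟩ => ⟨_, ha⟩, fun ⟨a, ha⟩ => ⟨σ.symm a, by simpa using ha⟩⟩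
    · intro σ _ τ _ h
      ext i
      exact congrArg Fin.val (g.injective (congrFun h i))
    · intro r hr
      simp only [Finset.mem_filter, Finset.mem_univ, true_and] at hr
      obtain ⟨hr, hrS⟩ := hr
      have hex : ∀ i, ∃ a, g a = r i := by
        intro i
        have : r i ∈ (S : Set ι) := by rw [← hrS]; simp
        rw [← Finset.range_orderEmbOfFin S hc] at this
        exact this
      choose s hs using hex
      have hsi : Function.Injective s := fun i j h => hr (by rw [← hs, ← hs, h])
      refine ⟨Equiv.ofBijective s (Finite.injective_iff_bijective.1 hsi), Finset.mem_univ _, ?_⟩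
      ext i
      simp [hs]
    · intro σ _
      simp
  · intro r hr
    simp only [Finset.mem_filter, Finset.mem_univ, true_and] at hr
    simp [Finset.mem_powersetCard, Finset.card_image_of_injective _ hr]

/-- If the last row vanishes except for its last entry, the determinant is that entry times the
complementary minor. -/
theorem det_eq_mul_of_last_row {R : Type*} [CommRing R] {m : ℕ}
    (A : Matrix (Fin (m + 1)) (Fin (m + 1)) R) (h : ∀ j : Fin m, A (Fin.last m) j.castSucc = 0) :
    A.det = A (Fin.last m) (Fin.last m) * (A.submatrix Fin.castSucc Fin.castSucc).det := by
  rw [det_succ_row A (Fin.last m), Fin.sum_univ_castSucc, Finset.sum_eq_zero]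
  · have h1 : ((-1 : R)) ^ ((Fin.last m : ℕ) + (Fin.last m : ℕ)) = 1 :=
      Even.neg_one_pow ⟨_, rfl⟩
    rw [h1, zero_add, one_mul, Fin.succAbove_last]
  · intro j _
    rw [h, mul_zero, zero_mul]

/-- If the last column vanishes except for its last entry, the determinant is that entry times the
complementary minor. -/
theorem det_eq_mul_of_last_col {R : Type*} [CommRing R] {m : ℕ}
    (A : Matrix (Fin (m + 1)) (Fin (m + 1)) R) (h : ∀ i : Fin m, A i.castSucc (Fin.last m) = 0) :
    A.det = A (Fin.last m) (Fin.last m) * (A.submatrix Fin.castSucc Fin.castSucc).det := by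
  rw [← det_transpose, det_eq_mul_of_last_row _ h, ← det_transpose (A.submatrix _ _)]
  rfl

end Matrix

/-! ### Polynomials with nonnegative coefficients. -/

namespace NonnegCoeffs

variable {σ : Type*} {p q : MvPolynomial σ ℝ}

theorem zero : NonnegCoeffs (0 : MvPolynomial σ ℝ) := fun m => by simp

theorem one : NonnegCoeffs (1 : MvPolynomial σ ℝ) := fun m => by
  classical
  rw [MvPolynomial.coeff_one]
  split_ifs <;> norm_num

theorem X (i : σ) : NonnegCoeffs (MvPolynomial.X i : MvPolynomial σ ℝ) := fun m => by
  classical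
  rw [MvPolynomial.coeff_X]
  split_ifs <;> norm_num

theorem mul (hp : NonnegCoeffs p) (hq : NonnegCoeffs q) : NonnegCoeffs (p * q) := fun m => by
  classical
  rw [MvPolynomial.coeff_mul]
  exact Finset.sum_nonneg fun x _ => mul_nonneg (hp _) (hq _)

theorem sum {ι : Type*} {s : Finset ι} {f : ι → MvPolynomial σ ℝ}
    (h : ∀ i ∈ s, NonnegCoeffs (f i)) : NonnegCoeffs (∑ i ∈ s, f i) := fun m => by
  rw [MvPolynomial.coeff_sum]
  exact Finset.sum_nonneg fun i hi => h i hi m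

theorem yPoly {Y : Type*} {ℓ : ℕ} {p : MvPolynomial Y ℝ} (hp : NonnegCoeffs p) :
    NonnegCoeffs (yPoly ℓ p) := fun m => by
  classical
  by_cases h : ∃ u : Y →₀ ℕ, u.mapDomain Sum.inr = m
  · obtain ⟨u, rfl⟩ := h
    rw [_root_.yPoly, MvPolynomial.coeff_rename_mapDomain _ Sum.inr_injective]
    exact hp u
  · rw [_root_.yPoly, MvPolynomial.coeff_rename_eq_zero]
    exact fun u hu => absurd ⟨u, hu⟩ h

end NonnegCoeffs

/-! ### Operations that preserve total positivity. -/

/-- The product of two infinite matrices, the first of which is lower triangular: only the entries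
of `A` on and below the diagonal enter. -/
def lowerMul {R : Type*} [CommRing R] (A B : Matrix ℕ ℕ R) : Matrix ℕ ℕ R :=
  Matrix.of fun i j => ∑ k ∈ Finset.range (i + 1), A i k * B k j

/-- A lower triangular infinite matrix. -/
def LowerTriangular {R : Type*} [Zero R] (A : Matrix ℕ ℕ R) : Prop := ∀ i j, i < j → A i j = 0

theorem lowerMul_apply_of_lt {R : Type*} [CommRing R] {A : Matrix ℕ ℕ R} (hA : LowerTriangular A)
    (B : Matrix ℕ ℕ R) {i N : ℕ} (hN : i < N) (j : ℕ) :
    lowerMul A B i j = ∑ k ∈ Finset.range N, A i k * B k j := by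
  refine Finset.sum_subset (Finset.range_subset_range.2 hN) fun k _ hk => ?_
  rw [hA i k (by simpa using hk), zero_mul]

/-- The submatrix formed by the columns with index less than `N` is totally positive. -/
def TotallyPositiveCols {σ : Type*} (N : ℕ) (A : Matrix ℕ ℕ (MvPolynomial σ ℝ)) : Prop :=
  ∀ (m : ℕ) (I J : Fin m → ℕ), StrictMono I → StrictMono J → (∀ i, J i < N) →
    NonnegCoeffs (A.submatrix I J).det

section

variable {σ : Type*} {A B : Matrix ℕ ℕ (MvPolynomial σ ℝ)} {N : ℕ}

theorem TotallyPositive.cols (h : TotallyPositive A) (N : ℕ) : TotallyPositiveCols N A :=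
  fun m I J hI hJ _ => h m I J hI hJ

theorem TotallyPositive.of_cols (h : ∀ N, TotallyPositiveCols N A) : TotallyPositive A :=
  fun m I J hI hJ => h (∑ i, J i + 1) m I J hI hJ fun i =>
    Nat.lt_succ_of_le (Finset.single_le_sum (f := J) (fun _ _ => Nat.zero_le _) (Finset.mem_univ i))

theorem TotallyPositiveCols.lowerMul (hA : TotallyPositive A) (hA' : LowerTriangular A)
    (hB : TotallyPositiveCols N B) : TotallyPositiveCols N (lowerMul A B) := by
  intro m I J hI hJ hJN
  set L := ∑ i, I i + 1 with hL
  have hIL : ∀ i, I i < L := fun i =>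
    Nat.lt_succ_of_le (Finset.single_le_sum (f := I) (fun _ _ => Nat.zero_le _) (Finset.mem_univ i))
  have h : (_root_.lowerMul A B).submatrix I J =
      A.submatrix I (Fin.val : Fin L → ℕ) * B.submatrix (Fin.val : Fin L → ℕ) J := by
    ext1 i j
    rw [Matrix.submatrix_apply, lowerMul_apply_of_lt hA' B (hIL i), Finset.sum_range,
      Matrix.mul_apply]
    rfl
  rw [h, Matrix.det_mul_eq_sum_powersetCard]
  refine NonnegCoeffs.sum fun S _ => ?_
  have hmono : StrictMono (Fin.val ∘ (S : Finset (Fin L)).orderEmbOfFin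
      (Finset.mem_powersetCard.1 S.2).2) := fun a b hab => by
    simpa using hab
  exact (hA m I _ hI hmono).mul (hB m _ J hmono hJ hJN)

theorem TotallyPositive.lowerMul (hA : TotallyPositive A) (hA' : LowerTriangular A)
    (hB : TotallyPositive B) : TotallyPositive (lowerMul A B) :=
  .of_cols fun N => TotallyPositiveCols.lowerMul hA hA' (hB.cols N)

/-- The matrix `A` with the column `(1, 0, 0, …)` added in front. -/
def consCol {R : Type*} [Zero R] [One R] (A : Matrix ℕ ℕ R) : Matrix ℕ ℕ R :=
  Matrix.of fun i j => match j with
    | 0 => if i = 0 then 1 else 0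
    | j + 1 => A i j

/-- A minor through the new column can have a nonzero entry there only in its top left corner, where
the entry is 0 or 1. Expanding along that column leaves a minor of `A`. -/
theorem TotallyPositiveCols.consCol (hA : TotallyPositiveCols N A) :
    TotallyPositiveCols (N + 1) (consCol A) := by
  intro m I J hI hJ hJN
  have hpos : ∀ (m : ℕ) (I J : Fin m → ℕ), StrictMono I → StrictMono J → (∀ i, J i < N + 1) →
      (∀ i, 0 < J i) → NonnegCoeffs ((_root_.consCol A).submatrix I J).det := by
    intro m I J hI hJ hJN h0
    have h : (_root_.consCol A).submatrix I J = A.submatrix I fun i => J i - 1 := by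
      ext1 i j
      obtain ⟨c, hc⟩ := Nat.exists_eq_succ_of_ne_zero (h0 j).ne'
      simp [_root_.consCol, hc]
    rw [h]
    refine hA m I _ hI (fun i j hij => ?_) fun i => ?_
    · have := hJ hij
      have := h0 i
      change J i - 1 < J j - 1
      omega
    · have := hJN i
      have := h0 i
      omega
  cases m with
  | zero => rw [Matrix.det_fin_zero]; exact .one
  | succ m =>
    by_cases h0 : J 0 = 0
    · have hrow : ∀ i : Fin m, (_root_.consCol A).submatrix I J i.succ 0 = 0 := by
        intro i
        have : I i.succ ≠ 0 := (lt_of_le_of_lt (Nat.zero_le _) (hI i.succ_pos)).ne'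
        simp [_root_.consCol, h0, this]
      rw [Matrix.det_succ_column_zero, Fin.sum_univ_succ, Finset.sum_eq_zero, add_zero]
      · simp only [Fin.val_zero, pow_zero, one_mul, Matrix.submatrix_submatrix]
        refine .mul ?_ (hpos m _ _ (hI.comp (Fin.strictMono_succ)) (hJ.comp Fin.strictMono_succ)
          (fun i => hJN _) fun i => ?_)
        · simp only [_root_.consCol, Matrix.submatrix_apply, h0, Matrix.of_apply]
          split_ifs
          exacts [.one, .zero]
        · exact lt_of_le_of_lt (Nat.zero_le _) (hJ i.succ_pos)
      · intro i _
        rw [hrow, mul_zero, zero_mul]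
    · exact hpos _ I J hI hJ hJN fun i =>
        lt_of_lt_of_le (Nat.pos_of_ne_zero h0) (hJ.monotone (Fin.zero_le i))

/-- A matrix which solves `N = L [e₀ | H N]` is totally positive. -/
theorem totallyPositive_of_eq_lowerMul_consCol {L H M : Matrix ℕ ℕ (MvPolynomial σ ℝ)}
    (hL : TotallyPositive L) (hL' : LowerTriangular L) (hH : TotallyPositive H)
    (hH' : LowerTriangular H) (hM : M = lowerMul L (consCol (lowerMul H M))) :
    TotallyPositive M := by
  refine .of_cols fun N => ?_
  induction N with
  | zero =>
    intro m I J _ _ hJ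
    cases m with
    | zero => rw [Matrix.det_fin_zero]; exact .one
    | succ m => exact absurd (hJ 0) (Nat.not_lt_zero _)
  -- On the right, the first `N + 1` columns involve only the first `N` columns of `M`.
  | succ N ih =>
    rw [hM]
    exact .lowerMul hL hL' (.consCol (.lowerMul hH hH' ih))

/-- A lower triangular matrix is totally positive if every minor can be reduced by expansion along
its last row or its last column. -/
theorem totallyPositive_of_last {σ : Type*} {D : Matrix ℕ ℕ (MvPolynomial σ ℝ)}
    (P : ℕ → Prop)
    (hP : ∀ (m : ℕ) (I J : Fin m → ℕ), StrictMono I → StrictMono J → (∀ i, P (I i)) →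
      NonnegCoeffs (D.submatrix I J).det)
    (hD : ∀ r c, ¬ P r → NonnegCoeffs (D r c))
    (hlast : ∀ r c, ¬ P r → (∀ j < c, D r j = 0) ∨ (∀ i < r, D i c = 0))
    (hmono : ∀ r s, r ≤ s → P s → P r) : TotallyPositive D := by
  intro m
  induction m with
  | zero => intro I J _ _; rw [Matrix.det_fin_zero]; exact .one
  | succ m ih =>
    intro I J hI hJ
    by_cases h : P (I (Fin.last m))
    · exact hP _ I J hI hJ fun i => hmono _ _ (hI.monotone (Fin.le_last i)) h
    · have key : (D.submatrix I J).det = D (I (Fin.last m)) (J (Fin.last m)) *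
          ((D.submatrix I J).submatrix Fin.castSucc Fin.castSucc).det := by
        rcases hlast _ (J (Fin.last m)) h with h1 | h1
        · exact Matrix.det_eq_mul_of_last_row _ fun j => h1 _ (hJ j.castSucc_lt_last)
        · exact Matrix.det_eq_mul_of_last_col _ fun j => h1 _ (hI j.castSucc_lt_last)
      rw [key, Matrix.submatrix_submatrix]
      exact (hD _ _ h).mul (ih _ _ (hI.comp Fin.strictMono_castSucc)
        (hJ.comp Fin.strictMono_castSucc))

/-- A lower bidiagonal matrix with nonnegative entries is totally positive. -/
theorem totallyPositive_of_bidiagonal {D : Matrix ℕ ℕ (MvPolynomial σ ℝ)}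
    (hD : ∀ r c, NonnegCoeffs (D r c)) (h : ∀ r c, r ≠ c → r ≠ c + 1 → D r c = 0) :
    TotallyPositive D := by
  refine totallyPositive_of_last (fun _ => False) (fun m I J _ _ hm => ?_) (fun r c _ => hD r c)
    (fun r c _ => ?_) fun _ _ _ h => h
  · cases m with
    | zero => rw [Matrix.det_fin_zero]; exact .one
    | succ m => exact (hm 0).elim
  -- Strictly below the diagonal everything to the left in row `r` vanishes; otherwise everything
  -- above in column `c` does.
  · rcases lt_or_ge c r with hc | hc
    · exact .inl fun j hj => h _ _ (by omega) (by omega)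
    · exact .inr fun i hi => h _ _ (by omega) (by omega)

/-- The matrix whose rows with index at most `n` are those of `A`, and whose rows with index
`r > n` are the unit vectors at `φ r`. -/
def truncRows {R : Type*} [Zero R] [One R] (n : ℕ) (φ : ℕ → ℕ) (A : Matrix ℕ ℕ R) :
    Matrix ℕ ℕ R :=
  Matrix.of fun r c => if r ≤ n then A r c else if c = φ r then 1 else 0

theorem LowerTriangular.truncRows {R : Type*} [Zero R] [One R] {A : Matrix ℕ ℕ R}
    (hA : LowerTriangular A) (n : ℕ) {φ : ℕ → ℕ} (hφ : ∀ r, φ r ≤ r) :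
    LowerTriangular (truncRows n φ A) := fun r c hrc => by
  have := hφ r
  simp only [_root_.truncRows, Matrix.of_apply, hA r c hrc]
  rw [if_neg (by omega : ¬ c = φ r), ite_self]

/-- The two bounds place the 1 of row `r > n` at column `r` or `r - 1`. If `c ≤ φ r`, the row
vanishes to the left of `c`; if `c > φ r`, then `c ≥ r` and triangularity makes column `c` vanish
above row `r`. So any minor reaching below row `n` shrinks. -/
theorem TotallyPositive.truncRows (hA : TotallyPositive A) (hA' : LowerTriangular A) (n : ℕ)
    {φ : ℕ → ℕ} (hφ : ∀ r, φ r ≤ r) (hφ' : ∀ r, r ≤ φ r + 1) :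
    TotallyPositive (truncRows n φ A) := by
  refine totallyPositive_of_last (fun r => r ≤ n) (fun m I J hI hJ hm => ?_) (fun r c hr => ?_)
    (fun r c hr => ?_) fun _ _ h h' => h.trans h'
  · have : (_root_.truncRows n φ A).submatrix I J = A.submatrix I J := by
      ext1 i j
      simp [_root_.truncRows, hm i]
    rw [this]
    exact hA m I J hI hJ
  · simp only [_root_.truncRows, Matrix.of_apply, if_neg hr]
    split_ifs
    exacts [.one, .zero]
  · rcases le_or_gt c (φ r) with hc | hc
    · refine .inl fun j hj => ?_
      simp only [_root_.truncRows, Matrix.of_apply, if_neg hr]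
      rw [if_neg (by omega)]
    · refine .inr fun i hi => hA'.truncRows n hφ _ _ ?_
      have := hφ' r
      omega

end

theorem exists_forall_lt {m : ℕ} (I : Fin m → ℕ) : ∃ N, ∀ i, I i < N :=
  ⟨∑ i, I i + 1, fun i => Nat.lt_succ_of_le
    (Finset.single_le_sum (f := I) (fun _ _ => Nat.zero_le _) (Finset.mem_univ i))⟩

theorem lowerMul_apply {R : Type*} [CommRing R] (A B : Matrix ℕ ℕ R) (i j : ℕ) :
    lowerMul A B i j = ∑ k ∈ Finset.range (i + 1), A i k * B k j :=
  rfl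

theorem lowerMul_apply_of_row_eq {R : Type*} [CommRing R] {A : Matrix ℕ ℕ R} {i k : ℕ}
    (hk : k ≤ i) (hA : ∀ c, A i c = if c = k then 1 else 0) (B : Matrix ℕ ℕ R) (j : ℕ) :
    lowerMul A B i j = B k j := by
  simp only [lowerMul, Matrix.of_apply, hA, ite_mul, one_mul, zero_mul]
  rw [Finset.sum_ite_eq' _ k, if_pos (Finset.mem_range.2 (Nat.lt_succ_of_le hk))]

/-! ### Toeplitz matrices of rows. -/

section

variable {σ : Type*}

/-- If `M = L [e₀ | H M]` with totally positive lower triangular matrices `L` and `H`, then the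
Toeplitz matrix of every row of `M` is totally positive. -/
theorem totallyPositive_toeplitz_row {L H M : Matrix ℕ ℕ (MvPolynomial σ ℝ)}
    (hL : TotallyPositive L) (hL' : LowerTriangular L) (hH : TotallyPositive H)
    (hH' : LowerTriangular H) (hM : M = lowerMul L (consCol (lowerMul H M))) (n : ℕ) :
    TotallyPositive (toeplitz fun k => M n k) := by
  -- Row `n + x` of `S` is row `n` of `M` shifted right by `x` places. It arises from the same
  -- equation when, above height `n`, `L` acts as the identity and `H` lowers the height by one, so
  -- that `S p (d + 1) = S (p - 1) d`.
  set S : Matrix ℕ ℕ (MvPolynomial σ ℝ) := Matrix.of fun p d =>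
    if p ≤ n then M p d else if p ≤ n + d then M n (d - (p - n)) else 0 with hS
  have hSM : ∀ p d, p ≤ n → S p d = M p d := fun p d hp => by simp [hS, hp]
  have hS_TP : TotallyPositive S := by
    refine totallyPositive_of_eq_lowerMul_consCol
      (hL.truncRows hL' n (φ := id) (fun r => le_rfl) fun r => Nat.le_succ r)
      (hL'.truncRows n fun r => le_rfl)
      (hH.truncRows hH' n (φ := Nat.pred) (fun r => Nat.pred_le r) fun r => Nat.le_add_of_sub_le le_rfl)
      (hH'.truncRows n fun r => Nat.pred_le r) ?_
    ext1 p d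
    rcases le_or_gt p n with hp | hp
    · rw [hSM p d hp, hM, lowerMul_apply, lowerMul_apply]
      refine Finset.sum_congr rfl fun k hk => ?_
      have hkn : k ≤ n := by have := Finset.mem_range.1 hk; omega
      have h1 : truncRows n id L p k = L p k := by simp [truncRows, hp]
      rw [h1]
      congr 1
      cases d with
      | zero => rfl
      | succ d =>
        change lowerMul H M k d = lowerMul (truncRows n Nat.pred H) S k d
        rw [lowerMul_apply, lowerMul_apply]
        refine Finset.sum_congr rfl fun c hc => ?_
        have hcn : c ≤ n := by have := Finset.mem_range.1 hc; omega
        rw [hSM c d hcn]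
        simp [truncRows, hkn]
    · rw [lowerMul_apply_of_row_eq (k := p) le_rfl
        (fun c => by simp [truncRows, Nat.not_le.2 hp])]
      cases d with
      | zero =>
        have h0 : p ≠ 0 := by omega
        simp [hS, consCol, Nat.not_le.2 hp, h0]
      | succ d =>
        change _ = lowerMul (truncRows n Nat.pred H) S p d
        rw [lowerMul_apply_of_row_eq (k := p.pred) (Nat.pred_le p)
          (fun c => by simp [truncRows, Nat.not_le.2 hp])]
        simp only [hS, Matrix.of_apply, Nat.pred_eq_sub_one]
        rw [if_neg (by omega)]
        by_cases h1 : p - 1 ≤ n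
        · have : p = n + 1 := by omega
          subst this
          simp
        · rw [if_neg h1]
          refine if_congr (by omega) ?_ rfl
          congr 1
          omega
  intro m I J hI hJ
  obtain ⟨NI, hNI⟩ := exists_forall_lt I
  obtain ⟨NJ, hNJ⟩ := exists_forall_lt J
  set X := max NI NJ
  have hIX : ∀ i, I i < X := fun i => (hNI i).trans_le (le_max_left _ _)
  have hJX : ∀ i, J i < X := fun i => (hNJ i).trans_le (le_max_right _ _)
  -- The lower part of `S` is the transposed Toeplitz pattern, with entry `M n (y - x)`. Reflecting
  -- the indices through `X` restores `i - j`, and reversing both rows and columns keeps the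
  -- determinant.
  have key : ((toeplitz fun k => M n k).submatrix I J).submatrix Fin.revPerm Fin.revPerm =
      S.submatrix (fun i => n + (X - I i.rev)) fun j => X - J j.rev := by
    ext1 i j
    have h1 := hIX i.rev
    have h2 := hJX j.rev
    simp only [Matrix.submatrix_apply, Fin.revPerm_apply, toeplitz, hS, Matrix.of_apply]
    rw [if_neg (by omega : ¬ n + (X - I i.rev) ≤ n)]
    refine if_congr (by omega) ?_ rfl
    congr 1
    omega
  rw [← Matrix.det_submatrix_equiv_self Fin.revPerm, key]
  refine hS_TP m _ _ (fun i j hij => ?_) fun i j hij => ?_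
  · have h1 := hIX i.rev
    have h2 := hI (Fin.rev_lt_rev.2 hij)
    change n + (X - I i.rev) < n + (X - I j.rev)
    omega
  · have h1 := hJX i.rev
    have h2 := hJ (Fin.rev_lt_rev.2 hij)
    change X - J i.rev < X - J j.rev
    omega

end

/-! ### The matrix of vertical runs. -/

/-- The matrix of the weights of vertical paths, where the step from height `n` to height `n + 1`
has weight `b (n + 1)`: the entry at `(n, m)` belongs to the path from height `m` to height `n`. -/
def verticalMatrix {R : Type*} [CommRing R] (b : ℕ → R) : Matrix ℕ ℕ R :=
  Matrix.of fun n m => if m ≤ n then ∏ k ∈ Finset.Ico m n, b (k + 1) else 0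

theorem lowerTriangular_verticalMatrix {R : Type*} [CommRing R] (b : ℕ → R) :
    LowerTriangular (verticalMatrix b) := fun i j hij => by
  simp [verticalMatrix, Nat.not_le.2 hij]

theorem verticalMatrix_self {R : Type*} [CommRing R] (b : ℕ → R) (n : ℕ) :
    verticalMatrix b n n = 1 := by
  simp [verticalMatrix]

theorem verticalMatrix_succ {R : Type*} [CommRing R] (b : ℕ → R) {n m : ℕ} (h : m ≤ n) :
    verticalMatrix b (n + 1) m = b (n + 1) * verticalMatrix b n m := by
  simp only [verticalMatrix, Matrix.of_apply, if_pos h, if_pos (h.trans n.le_succ)]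
  rw [Finset.prod_Ico_succ_top h, mul_comm]

theorem lowerMul_verticalMatrix_succ {R : Type*} [CommRing R] (b : ℕ → R) (A : Matrix ℕ ℕ R)
    (n k : ℕ) : lowerMul (verticalMatrix b) A (n + 1) k =
      b (n + 1) * lowerMul (verticalMatrix b) A n k + A (n + 1) k := by
  simp only [lowerMul, Matrix.of_apply]
  rw [Finset.sum_range_succ, verticalMatrix_self, one_mul, Finset.mul_sum]
  congr 1
  refine Finset.sum_congr rfl fun j hj => ?_
  rw [verticalMatrix_succ b (Nat.lt_succ_iff.1 (Finset.mem_range.1 hj)), mul_assoc]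

theorem lowerMul_verticalMatrix_zero {R : Type*} [CommRing R] (b : ℕ → R) (A : Matrix ℕ ℕ R)
    (k : ℕ) : lowerMul (verticalMatrix b) A 0 k = A 0 k := by
  simp [lowerMul, verticalMatrix_self]

/-- Truncating at height `N` gives a product of `N` elementary bidiagonal matrices, the factor `E`
adding the step from `N` to `N + 1`. A finite minor only sees some truncation. -/
theorem totallyPositive_verticalMatrix {σ : Type*} {b : ℕ → MvPolynomial σ ℝ}
    (hb : ∀ n, NonnegCoeffs (b n)) : TotallyPositive (verticalMatrix b) := by
  have key : ∀ N, TotallyPositive (truncRows N id (verticalMatrix b)) := by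
    intro N
    induction N with
    | zero =>
      have h : ∀ r c, truncRows 0 id (verticalMatrix b) r c = if c = r then 1 else 0 := by
        intro r c
        simp only [truncRows, verticalMatrix, Matrix.of_apply, id]
        rcases Nat.eq_zero_or_pos r with rfl | hr
        · by_cases hc : c = 0 <;> simp [hc]
        · rw [if_neg (by omega)]
      refine totallyPositive_of_bidiagonal (fun r c => ?_) fun r c h1 _ => ?_
      · rw [h]
        split_ifs
        exacts [.one, .zero]
      · rw [h, if_neg (Ne.symm h1)]
    | succ N ih =>
      set E : Matrix ℕ ℕ (MvPolynomial σ ℝ) := Matrix.of fun r c =>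
        if c = r then 1 else if r = N + 1 ∧ c = N then b (N + 1) else 0 with hE
      have hE_TP : TotallyPositive E := by
        refine totallyPositive_of_bidiagonal (fun r c => ?_) fun r c h1 h2 => ?_
        · simp only [hE, Matrix.of_apply]
          split_ifs
          exacts [.one, hb _, .zero]
        · simp only [hE, Matrix.of_apply]
          rw [if_neg (Ne.symm h1), if_neg (by omega)]
      have hE_lt : LowerTriangular E := fun r c hrc => by
        simp only [hE, Matrix.of_apply]
        rw [if_neg (by omega), if_neg (by omega)]
      have h : truncRows (N + 1) id (verticalMatrix b) =
          lowerMul E (truncRows N id (verticalMatrix b)) := by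
        ext1 r c
        by_cases hr : r = N + 1
        · subst hr
          simp only [lowerMul, Matrix.of_apply]
          rw [Finset.sum_range_succ, Finset.sum_range_succ, Finset.sum_eq_zero, zero_add]
          · simp only [hE, truncRows, Matrix.of_apply, le_refl, if_true, and_self, id, one_mul,
              Nat.not_succ_le_self, if_false]
            rw [if_neg (by omega)]
            rcases Nat.lt_trichotomy c (N + 1) with hc | rfl | hc
            · rw [verticalMatrix_succ b (Nat.lt_succ_iff.1 hc), if_neg hc.ne, add_zero]
            · rw [verticalMatrix_self, lowerTriangular_verticalMatrix b N (N + 1) N.lt_succ_self]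
              simp
            · rw [lowerTriangular_verticalMatrix b _ _ hc,
                lowerTriangular_verticalMatrix b N c (by omega), if_neg hc.ne']
              simp
          · intro k hk
            have := Finset.mem_range.1 hk
            simp only [hE, Matrix.of_apply]
            rw [if_neg (by omega), if_neg (by omega), zero_mul]
        · rw [lowerMul_apply_of_row_eq (k := r) le_rfl (fun c => by simp [hE, hr])]
          simp only [truncRows, Matrix.of_apply]
          exact if_congr (by omega) rfl rfl
      rw [h]
      exact hE_TP.lowerMul hE_lt ih
  intro m I J hI hJ
  obtain ⟨N, hN⟩ := exists_forall_lt I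
  have h : (verticalMatrix b).submatrix I J =
      (truncRows N id (verticalMatrix b)).submatrix I J := by
    ext1 i j
    simp [truncRows, (hN i).le]
  rw [h]
  exact key N m I J hI hJ

/-! ### Toeplitz matrices of power series, and the geometric series. -/

/-- The Toeplitz matrix of the coefficients of a formal power series. -/
noncomputable def seriesToeplitz {R : Type*} [CommRing R] (φ : PowerSeries R) : Matrix ℕ ℕ R :=
  toeplitz fun n => PowerSeries.coeff n φ

section

variable {R : Type*} [CommRing R]

theorem lowerTriangular_toeplitz (s : ℕ → R) : LowerTriangular (toeplitz s) := fun i j hij => by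
  simp [toeplitz, Nat.not_le.2 hij]

theorem lowerMul_seriesToeplitz (φ : PowerSeries R) (A : Matrix ℕ ℕ R) (n k : ℕ) :
    lowerMul (seriesToeplitz φ) A n k =
      PowerSeries.coeff n (φ * PowerSeries.mk fun i => A i k) := by
  rw [lowerMul_apply, mul_comm, PowerSeries.coeff_mul, Finset.Nat.sum_antidiagonal_eq_sum_range_succ_mk]
  refine Finset.sum_congr rfl fun j hj => ?_
  simp [seriesToeplitz, toeplitz, Nat.lt_succ_iff.1 (Finset.mem_range.1 hj), mul_comm]

theorem lowerMul_seriesToeplitz_seriesToeplitz (φ ψ : PowerSeries R) :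
    lowerMul (seriesToeplitz φ) (seriesToeplitz ψ) = seriesToeplitz (φ * ψ) := by
  ext1 n k
  have h : PowerSeries.mk (fun i => seriesToeplitz ψ i k) = PowerSeries.X ^ k * ψ := by
    ext i
    simp [PowerSeries.coeff_X_pow_mul', seriesToeplitz, toeplitz]
  rw [lowerMul_seriesToeplitz, h, mul_left_comm, PowerSeries.coeff_X_pow_mul']
  rfl

end

section

variable {σ : Type*} {φ ψ : PowerSeries (MvPolynomial σ ℝ)}

theorem TotallyPositive.seriesToeplitz_mul (hφ : TotallyPositive (seriesToeplitz φ))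
    (hψ : TotallyPositive (seriesToeplitz ψ)) : TotallyPositive (seriesToeplitz (φ * ψ)) := by
  rw [← lowerMul_seriesToeplitz_seriesToeplitz]
  exact hφ.lowerMul (lowerTriangular_toeplitz _) hψ

theorem totallyPositive_seriesToeplitz_linear {p q : MvPolynomial σ ℝ} (hp : NonnegCoeffs p)
    (hq : NonnegCoeffs q) :
    TotallyPositive (seriesToeplitz (PowerSeries.C p * PowerSeries.X + PowerSeries.C q)) := by
  have h : ∀ n, PowerSeries.coeff n (PowerSeries.C p * PowerSeries.X + PowerSeries.C q) =
      if n = 0 then q else if n = 1 then p else 0 := by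
    intro n
    rcases n with _ | _ | n
    · simp
    · simp [PowerSeries.coeff_C]
    · simp
  refine totallyPositive_of_bidiagonal (fun r c => ?_) fun r c h1 h2 => ?_
  · simp only [seriesToeplitz, toeplitz, Matrix.of_apply, h]
    split_ifs
    exacts [hq, hp, .zero, .zero]
  · simp only [seriesToeplitz, toeplitz, Matrix.of_apply, h]
    split_ifs
    · omega
    · omega
    · rfl
    · rfl

theorem totallyPositive_seriesToeplitz_one :
    TotallyPositive (seriesToeplitz (1 : PowerSeries (MvPolynomial σ ℝ))) := by
  have := totallyPositive_seriesToeplitz_linear (σ := σ) .zero .one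
  simpa using this

theorem totallyPositive_seriesToeplitz_X :
    TotallyPositive (seriesToeplitz (PowerSeries.X : PowerSeries (MvPolynomial σ ℝ))) := by
  have := totallyPositive_seriesToeplitz_linear (σ := σ) .one .zero
  simpa using this

theorem TotallyPositive.seriesToeplitz_pow (hφ : TotallyPositive (seriesToeplitz φ)) (n : ℕ) :
    TotallyPositive (seriesToeplitz (φ ^ n)) := by
  induction n with
  | zero => rw [pow_zero]; exact totallyPositive_seriesToeplitz_one
  | succ n ih => rw [pow_succ]; exact ih.seriesToeplitz_mul hφ

theorem totallyPositive_seriesToeplitz_prod {ι : Type*} (s : Finset ι)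
    {f : ι → PowerSeries (MvPolynomial σ ℝ)}
    (hf : ∀ i ∈ s, TotallyPositive (seriesToeplitz (f i))) :
    TotallyPositive (seriesToeplitz (∏ i ∈ s, f i)) :=
  Finset.prod_induction f (fun φ => TotallyPositive (seriesToeplitz φ))
    (fun _ _ h h' => h.seriesToeplitz_mul h') totallyPositive_seriesToeplitz_one hf

end

section

variable {R : Type*} [CommRing R]

theorem one_sub_mul_invOfUnit (γ : R) :
    (1 - PowerSeries.C γ * PowerSeries.X) *
      PowerSeries.invOfUnit (1 - PowerSeries.C γ * PowerSeries.X) 1 = 1 :=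
  PowerSeries.mul_invOfUnit _ _ (by simp)

theorem invOfUnit_one_sub (γ : R) :
    PowerSeries.invOfUnit (1 - PowerSeries.C γ * PowerSeries.X) 1 =
      PowerSeries.rescale γ (PowerSeries.mk 1) := by
  have h : (1 - PowerSeries.C γ * PowerSeries.X) * PowerSeries.rescale γ (PowerSeries.mk 1) = 1 := by
    have := congrArg (PowerSeries.rescale γ) (PowerSeries.mk_one_mul_one_sub_eq_one R)
    rw [map_mul, map_sub, map_one, PowerSeries.rescale_X] at this
    rw [mul_comm, this]
  calc _ = ((1 - PowerSeries.C γ * PowerSeries.X) * PowerSeries.rescale γ (PowerSeries.mk 1)) *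
        PowerSeries.invOfUnit (1 - PowerSeries.C γ * PowerSeries.X) 1 := by rw [h, one_mul]
    _ = PowerSeries.rescale γ (PowerSeries.mk 1) * ((1 - PowerSeries.C γ * PowerSeries.X) *
        PowerSeries.invOfUnit (1 - PowerSeries.C γ * PowerSeries.X) 1) := by ring
    _ = _ := by rw [one_sub_mul_invOfUnit, mul_one]

theorem coeff_invOfUnit_one_sub_pow (γ : R) (k i : ℕ) :
    PowerSeries.coeff i (PowerSeries.invOfUnit (1 - PowerSeries.C γ * PowerSeries.X) 1 ^ (k + 1)) =
      ((k + i).choose i : R) * γ ^ i := by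
  rw [invOfUnit_one_sub, ← map_pow, PowerSeries.mk_one_pow_eq_mk_choose_add,
    PowerSeries.coeff_rescale, PowerSeries.coeff_mk, mul_comm, Nat.choose_symm_add]

/-- This identifies `L` for constant weights, so the path equation becomes one between generating
functions. -/
theorem seriesToeplitz_invOfUnit_one_sub (γ : R) :
    seriesToeplitz (PowerSeries.invOfUnit (1 - PowerSeries.C γ * PowerSeries.X) 1) =
      verticalMatrix fun _ => γ := by
  ext1 i j
  simp [invOfUnit_one_sub, seriesToeplitz, toeplitz, verticalMatrix, PowerSeries.coeff_rescale]

end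

/-! ### The last-step recurrence and the matrix equation. -/

section

variable {R : Type*} [CommRing R] {t ℓ : ℕ}

open Classical in
theorem latticePaths_toFinset_eq (t ℓ n k : ℕ) : (latticePaths_finite t ℓ n k).toFinset =
    ((if n = 0 ∧ k = 0 then {[]} else ∅) ∪
      if 1 ≤ n then
        (latticePaths_finite t ℓ (n - 1) k).toFinset.image (List.cons LatticeStep.up) else ∅) ∪
      if 1 ≤ k then Finset.univ.biUnion fun i : Fin (ℓ + 1) => if t + i ≤ n then
        (latticePaths_finite t ℓ (n - (t + i)) (k - 1)).toFinset.image
          (List.cons (LatticeStep.diag i)) else ∅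
      else ∅ := by
  ext p
  rcases p with _ | ⟨_ | i, p⟩
  · by_cases hn : n = 0 <;> by_cases hk : k = 0 <;>
      simp [latticePaths, pathX, pathY, hn, hk, eq_comm, Nat.one_le_iff_ne_zero] <;> aesop
  · have h1 : ¬ ∃ i : Fin (ℓ + 1), (LatticeStep.up :: p) ∈ if t + i ≤ n then
        (latticePaths_finite t ℓ (n - (t + i)) (k - 1)).toFinset.image
          (List.cons (LatticeStep.diag i)) else ∅ := by
      rintro ⟨i, hi⟩
      split_ifs at hi <;> simp at hi
    have h2 : (LatticeStep.up :: p) ∉ if 1 ≤ k then Finset.univ.biUnion fun i : Fin (ℓ + 1) =>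
        if t + i ≤ n then (latticePaths_finite t ℓ (n - (t + i)) (k - 1)).toFinset.image
          (List.cons (LatticeStep.diag i)) else ∅ else ∅ := by
      split_ifs
      · simpa using h1
      · simp
    have h3 : (LatticeStep.up :: p) ∉
        (if n = 0 ∧ k = 0 then {[]} else ∅ : Finset (List (LatticeStep ℓ))) := by
      split_ifs <;> simp
    rw [Finset.mem_union, Finset.mem_union, or_iff_left h2, or_iff_right h3]
    by_cases hn : 1 ≤ n
    · simp only [Set.Finite.mem_toFinset, latticePaths, Set.mem_ofPred_eq, pathX, pathY,
        LatticeStep.dx, LatticeStep.dy, if_pos hn, Finset.mem_image, List.cons.injEq, true_and,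
        exists_eq_right]
      omega
    · simp only [Set.Finite.mem_toFinset, latticePaths, Set.mem_ofPred_eq, pathX, pathY,
        LatticeStep.dx, LatticeStep.dy, if_neg hn, Finset.notMem_empty, iff_false]
      omega
  · have h2 : (LatticeStep.diag i :: p) ∉ if 1 ≤ n then
        (latticePaths_finite t ℓ (n - 1) k).toFinset.image (List.cons LatticeStep.up) else ∅ := by
      split_ifs <;> simp
    have h3 : (LatticeStep.diag i :: p) ∉
        (if n = 0 ∧ k = 0 then {[]} else ∅ : Finset (List (LatticeStep ℓ))) := by
      split_ifs <;> simp
    rw [Finset.mem_union, Finset.mem_union, or_iff_right (not_or.2 ⟨h3, h2⟩)]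
    by_cases hk : 1 ≤ k
    · rw [if_pos hk]
      simp only [Finset.mem_biUnion, Finset.mem_univ, true_and]
      have h4 : (∃ j : Fin (ℓ + 1), (LatticeStep.diag i :: p) ∈ if t + j ≤ n then
          (latticePaths_finite t ℓ (n - (t + j)) (k - 1)).toFinset.image
          (List.cons (LatticeStep.diag j)) else ∅) ↔ t + i ≤ n ∧
            p ∈ (latticePaths_finite t ℓ (n - (t + i)) (k - 1)).toFinset := by
        constructor
        · rintro ⟨j, hj⟩
          split_ifs at hj with h
          · simp only [Finset.mem_image, List.cons.injEq, LatticeStep.diag.injEq] at hj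
            obtain ⟨q, hq, rfl, rfl⟩ := hj
            exact ⟨h, hq⟩
          · simp at hj
        · rintro ⟨h, hp⟩
          exact ⟨i, by rw [if_pos h]; exact Finset.mem_image_of_mem _ hp⟩
      rw [h4]
      simp only [Set.Finite.mem_toFinset, latticePaths, Set.mem_ofPred_eq, pathX, pathY,
        LatticeStep.dx, LatticeStep.dy]
      omega
    · simp only [Set.Finite.mem_toFinset, latticePaths, Set.mem_ofPred_eq, pathX, pathY,
        LatticeStep.dx, LatticeStep.dy, if_neg hk, Finset.notMem_empty, iff_false]
      omega

theorem sum_cons_latticePaths (a : ℕ → Fin (ℓ + 1) → R) (b : ℕ → R) (s : LatticeStep ℓ)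
    {n n' k : ℕ} (h : n' + s.dy t = n) :
    ∑ p ∈ (latticePaths_finite t ℓ n' k).toFinset, pathWeight t a b (s :: p) =
      s.weight a b n * pathMatrix t ℓ a b n' k := by
  simp only [pathMatrix, Matrix.of_apply]
  rw [Finset.mul_sum]
  refine Finset.sum_congr rfl fun p hp => ?_
  have hp : pathX p = k ∧ pathY t p = n' := by simpa [latticePaths] using hp
  rw [pathWeight, pathY, hp.2, h, mul_comm]

/-- The recurrence obtained by removing the last step of a path. -/
theorem pathMatrix_eq (a : ℕ → Fin (ℓ + 1) → R) (b : ℕ → R) (n k : ℕ) :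
    pathMatrix t ℓ a b n k = (if n = 0 ∧ k = 0 then 1 else 0) +
      (if 1 ≤ n then b n * pathMatrix t ℓ a b (n - 1) k else 0) +
      if 1 ≤ k then ∑ i : Fin (ℓ + 1), if t + i ≤ n then
        a n i * pathMatrix t ℓ a b (n - (t + i)) (k - 1) else 0 else 0 := by
  classical
  conv_lhs => rw [pathMatrix, Matrix.of_apply, latticePaths_toFinset_eq]
  rw [Finset.sum_union, Finset.sum_union]
  · congr 1
    · congr 1
      · split_ifs <;> simp [pathWeight]
      · split_ifs with hn
        · rw [Finset.sum_image fun _ _ _ _ h => (List.cons.inj h).2,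
            sum_cons_latticePaths a b LatticeStep.up (n := n)
              (by simp only [LatticeStep.dy]; omega)]
          rfl
        · simp
    · split_ifs with hk
      · rw [Finset.sum_biUnion]
        · refine Finset.sum_congr rfl fun i _ => ?_
          split_ifs with h
          · rw [Finset.sum_image fun _ _ _ _ h => (List.cons.inj h).2,
              sum_cons_latticePaths a b (LatticeStep.diag i) (n := n)
                (by simp only [LatticeStep.dy]; omega)]
            rfl
          · simp
        · intro i _ j _ hij
          change Disjoint _ _
          rw [Finset.disjoint_left]
          intro p hp hp'
          beta_reduce at hp hp'
          split_ifs at hp hp'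
          · simp only [Finset.mem_image] at hp hp'
            obtain ⟨q, _, rfl⟩ := hp
            obtain ⟨q', _, hq'⟩ := hp'
            simp only [List.cons.injEq, LatticeStep.diag.injEq] at hq'
            exact hij hq'.1.symm
          all_goals simp at hp hp'
      · simp
  · rw [Finset.disjoint_left]
    intro p hp hp'
    split_ifs at hp hp'
    · rw [Finset.mem_singleton] at hp
      simp [hp] at hp'
    all_goals simp at hp hp'
  · rw [Finset.disjoint_left]
    intro p hp hp'
    rw [Finset.mem_union] at hp
    split_ifs at hp'
    · simp only [Finset.mem_biUnion, Finset.mem_univ, true_and] at hp'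
      obtain ⟨i, hi⟩ := hp'
      split_ifs at hi
      · obtain ⟨q, _, rfl⟩ := Finset.mem_image.1 hi
        rcases hp with hp | hp <;> split_ifs at hp <;> simp at hp
      · simp at hi
    · simp at hp'

/-- The generating function of the weights of the steps `(1, t + i)`. -/
noncomputable def stepSeries (t : ℕ) {ℓ : ℕ} (a : Fin (ℓ + 1) → R) : PowerSeries R :=
  ∑ i : Fin (ℓ + 1), PowerSeries.C (a i) * PowerSeries.X ^ (t + (i : ℕ))

theorem coeff_stepSeries_mul (a : Fin (ℓ + 1) → R) (φ : PowerSeries R) (n : ℕ) :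
    PowerSeries.coeff n (stepSeries t a * φ) =
      ∑ i : Fin (ℓ + 1), if t + i ≤ n then a i * PowerSeries.coeff (n - (t + i)) φ else 0 := by
  simp only [stepSeries, Finset.sum_mul, map_sum, mul_assoc, PowerSeries.coeff_C_mul,
    PowerSeries.coeff_X_pow_mul', mul_ite, mul_zero]

/-- The final vertical run is `L`, the diagonal step before it is `H`. Both sides satisfy the same
first-order recurrence in `n`. -/
theorem pathMatrix_eq_lowerMul (a : Fin (ℓ + 1) → R) (b : ℕ → R) :
    pathMatrix t ℓ (fun _ => a) b = lowerMul (verticalMatrix b)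
      (consCol (lowerMul (seriesToeplitz (stepSeries t a)) (pathMatrix t ℓ (fun _ => a) b))) := by
  ext1 n k
  have h0 : ∀ n k, consCol (lowerMul (seriesToeplitz (stepSeries t a))
      (pathMatrix t ℓ (fun _ => a) b)) n k = (if n = 0 ∧ k = 0 then 1 else 0) +
      if 1 ≤ k then ∑ i : Fin (ℓ + 1), if t + i ≤ n then
        a i * pathMatrix t ℓ (fun _ => a) b (n - (t + i)) (k - 1) else 0 else 0 := by
    intro n k
    cases k with
    | zero => simp [consCol]
    | succ k =>
      change lowerMul _ _ n k = _
      rw [lowerMul_seriesToeplitz, coeff_stepSeries_mul]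
      simp
  induction n with
  | zero =>
    rw [lowerMul_verticalMatrix_zero, h0, pathMatrix_eq]
    simp
  | succ n ih =>
    rw [lowerMul_verticalMatrix_succ, ← ih, h0, pathMatrix_eq]
    simp

end

/-! ### The step series as a product of linear factors. -/

section

variable {ℓ : ℕ} {Y : Type*}

/-- The product of the linear factors `α j z + β j` as a formal power series. -/
noncomputable def factorSeries (ℓ : ℕ) (Y : Type*) : PowerSeries (WeightRing ℓ Y) :=
  ∏ j : Fin ℓ, (PowerSeries.C (alphaVar Y j) * PowerSeries.X + PowerSeries.C (betaVar Y j))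

theorem totallyPositive_factorSeries : TotallyPositive (seriesToeplitz (factorSeries ℓ Y)) :=
  totallyPositive_seriesToeplitz_prod _ fun _ _ =>
    totallyPositive_seriesToeplitz_linear (.X _) (.X _)

theorem stepSeries_eq (t : ℕ) {a : Fin (ℓ + 1) → WeightRing ℓ Y}
    (ha : ∑ i : Fin (ℓ + 1), Polynomial.C (a i) * Polynomial.X ^ (i : ℕ) =
      ∏ j : Fin ℓ, (Polynomial.C (alphaVar Y j) * Polynomial.X + Polynomial.C (betaVar Y j))) :
    stepSeries t a = PowerSeries.X ^ t * factorSeries ℓ Y := by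
  have h := congrArg (Polynomial.coeToPowerSeries.ringHom (R := WeightRing ℓ Y)) ha
  simp only [map_sum, map_prod, map_add, map_mul, map_pow,
    Polynomial.coeToPowerSeries.ringHom_apply, Polynomial.coe_C, Polynomial.coe_X] at h
  rw [factorSeries, ← h, stepSeries, Finset.mul_sum]
  exact Finset.sum_congr rfl fun i _ => by rw [pow_add]; ring

theorem eq_of_sum_C_mul_X_pow_eq {R : Type*} [CommRing R] {a a' : Fin (ℓ + 1) → R}
    (h : ∑ i : Fin (ℓ + 1), Polynomial.C (a i) * Polynomial.X ^ (i : ℕ) =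
      ∑ i : Fin (ℓ + 1), Polynomial.C (a' i) * Polynomial.X ^ (i : ℕ)) : a = a' := by
  funext j
  have h := congrArg (fun p => Polynomial.coeff p (j : ℕ)) h
  simpa [Polynomial.finsetSum_coeff, Polynomial.coeff_X_pow, Fin.val_inj] using h

theorem totallyPositive_stepSeries (t : ℕ) {a : Fin (ℓ + 1) → WeightRing ℓ Y}
    (ha : ∑ i : Fin (ℓ + 1), Polynomial.C (a i) * Polynomial.X ^ (i : ℕ) =
      ∏ j : Fin ℓ, (Polynomial.C (alphaVar Y j) * Polynomial.X + Polynomial.C (betaVar Y j))) :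
    TotallyPositive (seriesToeplitz (stepSeries t a)) := by
  rw [stepSeries_eq t ha]
  exact (totallyPositive_seriesToeplitz_X.seriesToeplitz_pow t).seriesToeplitz_mul
    totallyPositive_factorSeries

theorem totallyPositive_seriesToeplitz_invOfUnit {γ : MvPolynomial Y ℝ} (hγ : NonnegCoeffs γ) :
    TotallyPositive (seriesToeplitz
      (PowerSeries.invOfUnit (1 - PowerSeries.C (yPoly ℓ γ) * PowerSeries.X) 1)) := by
  rw [seriesToeplitz_invOfUnit_one_sub]
  exact totallyPositive_verticalMatrix fun _ => hγ.yPoly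

end

/-! ### Riordan array and bivariate generating function. -/

section

variable {R : Type*} [CommRing R] {t ℓ : ℕ}

/-- The columns of the path matrix form a Riordan array if the vertical weights are constant. -/
theorem pathMatrix_eq_riordan (a : Fin (ℓ + 1) → R) (γ : R) :
    pathMatrix t ℓ (fun _ => a) (fun _ => γ) = riordan
      (PowerSeries.invOfUnit (1 - PowerSeries.C γ * PowerSeries.X) 1)
      (stepSeries t a * PowerSeries.invOfUnit (1 - PowerSeries.C γ * PowerSeries.X) 1) := by
  set g := PowerSeries.invOfUnit (1 - PowerSeries.C γ * PowerSeries.X) 1 with hg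
  set M := pathMatrix t ℓ (fun _ => a) (fun _ => γ) with hM
  have hrec : M = lowerMul (seriesToeplitz g)
      (consCol (lowerMul (seriesToeplitz (stepSeries t a)) M)) := by
    rw [hg, seriesToeplitz_invOfUnit_one_sub]
    exact pathMatrix_eq_lowerMul a _
  -- The matrix equation, read column by column: column 0 is `g`, and each next column is multiplied
  -- by `g * stepSeries t a`.
  have key : ∀ k, (PowerSeries.mk fun n => M n k) = g * (stepSeries t a * g) ^ k := by
    intro k
    induction k with
    | zero =>
      ext n
      rw [PowerSeries.coeff_mk, hrec, lowerMul_seriesToeplitz, pow_zero]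
      congr 2
      ext i
      simp [consCol, PowerSeries.coeff_one]
    | succ k ih =>
      ext n
      rw [PowerSeries.coeff_mk, hrec, lowerMul_seriesToeplitz, pow_succ]
      congr 1
      have : (PowerSeries.mk fun i =>
          consCol (lowerMul (seriesToeplitz (stepSeries t a)) M) i (k + 1)) =
          stepSeries t a * PowerSeries.mk fun i => M i k := by
        ext i
        rw [← lowerMul_seriesToeplitz, PowerSeries.coeff_mk]
        rfl
      rw [this, ih]
      ring
  ext1 n k
  have := congrArg (PowerSeries.coeff n) (key k)
  rwa [PowerSeries.coeff_mk] at this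

theorem bivariateGF_pathMatrix (a : Fin (ℓ + 1) → R) (γ : R) :
    bivariateGF (pathMatrix t ℓ (fun _ => a) (fun _ => γ)) =
      MvPowerSeries.invOfUnit (1 - MvPowerSeries.C γ * MvPowerSeries.X 1 - MvPowerSeries.X 0 *
        ∑ i : Fin (ℓ + 1), MvPowerSeries.C (a i) * MvPowerSeries.X 1 ^ (t + (i : ℕ))) 1 := by
  classical
  set M := pathMatrix t ℓ (fun _ => a) (fun _ => γ) with hM
  set F := bivariateGF M with hF
  set D : MvPowerSeries (Fin 2) R := 1 - MvPowerSeries.C γ * MvPowerSeries.X 1 -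
    MvPowerSeries.X 0 *
      ∑ i : Fin (ℓ + 1), MvPowerSeries.C (a i) * MvPowerSeries.X 1 ^ (t + (i : ℕ)) with hD
  have hcF : ∀ e, MvPowerSeries.coeff e F = M (e 1) (e 0) := fun e => rfl
  have hle : ∀ (x y : ℕ) (e : Fin 2 →₀ ℕ),
      Finsupp.single 0 x + Finsupp.single 1 y ≤ e ↔ x ≤ e 0 ∧ y ≤ e 1 := by
    intro x y e
    rw [Finsupp.le_def, Fin.forall_fin_two]
    simp
  have hmon : ∀ (x y : ℕ) (c : R) (e : Fin 2 →₀ ℕ), MvPowerSeries.coeff e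
      (MvPowerSeries.monomial (Finsupp.single 0 x + Finsupp.single 1 y) c * F) =
      if x ≤ e 0 ∧ y ≤ e 1 then c * M (e 1 - y) (e 0 - x) else 0 := by
    intro x y c e
    rw [MvPowerSeries.coeff_monomial_mul]
    refine if_congr (hle x y e) ?_ rfl
    rw [hcF]
    simp
  have hDeq : D = 1 - MvPowerSeries.monomial (Finsupp.single 0 0 + Finsupp.single 1 1) γ -
      ∑ i : Fin (ℓ + 1), MvPowerSeries.monomial
        (Finsupp.single 0 1 + Finsupp.single 1 (t + (i : ℕ))) (a i) := by
    rw [hD, Finset.mul_sum]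
    congr 1
    · rw [MvPowerSeries.X, ← MvPowerSeries.monomial_zero_eq_C_apply, MvPowerSeries.monomial_mul_monomial]
      simp
    · refine Finset.sum_congr rfl fun i _ => ?_
      rw [MvPowerSeries.X_pow_eq, MvPowerSeries.X, ← MvPowerSeries.monomial_zero_eq_C_apply,
        MvPowerSeries.monomial_mul_monomial, MvPowerSeries.monomial_mul_monomial]
      simp
  -- Coefficientwise this is exactly the last-step recurrence `pathMatrix_eq`.
  have hmul : D * F = 1 := by
    ext e
    rw [hDeq, sub_mul, sub_mul, one_mul, Finset.sum_mul, map_sub, map_sub, map_sum, hcF, hmon,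
      hM, pathMatrix_eq, MvPowerSeries.coeff_one]
    simp only [hmon]
    have he : e = 0 ↔ e 1 = 0 ∧ e 0 = 0 := by
      rw [Finsupp.ext_iff, Fin.forall_fin_two]
      simp [and_comm]
    rw [if_congr he rfl rfl]
    by_cases h0 : 1 ≤ e 0
    · simp only [h0, hM, true_and, Nat.zero_le, if_true, Nat.sub_zero]
      ring
    · simp [h0]
  have hinv : D * MvPowerSeries.invOfUnit D 1 = 1 := by
    refine MvPowerSeries.mul_invOfUnit _ _ ?_
    simp [hD]
  calc F = (D * MvPowerSeries.invOfUnit D 1) * F := by rw [hinv, one_mul]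
    _ = (D * F) * MvPowerSeries.invOfUnit D 1 := by ring
    _ = _ := by rw [hmul, one_mul]

end

/-! ### Toeplitz matrices along lines and columns, and the explicit formula. -/

section

variable {t ℓ : ℕ} {Y : Type*}

theorem totallyPositive_toeplitz_zero {σ : Type*} :
    TotallyPositive (toeplitz fun _ => (0 : MvPolynomial σ ℝ)) :=
  totallyPositive_of_bidiagonal (fun r c => by simpa [toeplitz] using NonnegCoeffs.zero)
    fun r c _ _ => by simp [toeplitz]

/-- The coefficients of `φ ψ` times the powers of `φ χ`, read along a line. -/
theorem totallyPositive_toeplitz_coeff_mul_pow {σ : Type*} {φ χ : PowerSeries (MvPolynomial σ ℝ)}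
    (hφ : TotallyPositive (seriesToeplitz φ)) (hχ : TotallyPositive (seriesToeplitz χ)) (n : ℕ) :
    TotallyPositive (toeplitz fun i => PowerSeries.coeff n (φ * (φ * χ) ^ i)) := by
  set N : Matrix ℕ ℕ (MvPolynomial σ ℝ) :=
    Matrix.of fun p i => PowerSeries.coeff p (φ * (φ * χ) ^ i) with hN
  refine totallyPositive_toeplitz_row (M := N) hφ (lowerTriangular_toeplitz _) hχ
    (lowerTriangular_toeplitz _) ?_ n
  ext1 p i
  rw [lowerMul_seriesToeplitz]
  cases i with
  | zero =>
    have : (PowerSeries.mk fun i => consCol (lowerMul (seriesToeplitz χ) N) i 0) = 1 := by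
      refine PowerSeries.ext fun i => ?_
      rw [PowerSeries.coeff_mk, PowerSeries.coeff_one]
      rfl
    rw [this]
    simp only [hN, Matrix.of_apply, pow_zero]
  | succ d =>
    have hcol : (PowerSeries.mk fun i => N i d) = φ * (φ * χ) ^ d :=
      PowerSeries.ext fun i => PowerSeries.coeff_mk i _
    have hcons : (PowerSeries.mk fun i => consCol (lowerMul (seriesToeplitz χ) N) i (d + 1)) =
        χ * (φ * (φ * χ) ^ d) := by
      rw [← hcol]
      refine PowerSeries.ext fun i => ?_
      rw [PowerSeries.coeff_mk, ← lowerMul_seriesToeplitz]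
      rfl
    have h : φ * (χ * (φ * (φ * χ) ^ d)) = φ * (φ * χ) ^ (d + 1) := by
      rw [pow_succ', mul_left_comm χ φ, mul_assoc φ χ]
    rw [hcons, h]
    rfl

/-- With `Q` the product of the linear factors, column `k + s i` is `z^(t k + δ i) φ (φ χ)^i`. The
shift `δ i` cancels against the row index `n + δ i`, leaving row `n - t k` of the array of `φ` and
`φ χ`, to which the row theorem applies. -/
theorem totallyPositive_toeplitz_line (ht : 1 ≤ t) {a : Fin (ℓ + 1) → WeightRing ℓ Y}
    (ha : ∑ i : Fin (ℓ + 1), Polynomial.C (a i) * Polynomial.X ^ (i : ℕ) =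
      ∏ j : Fin ℓ, (Polynomial.C (alphaVar Y j) * Polynomial.X + Polynomial.C (betaVar Y j)))
    {γ : MvPolynomial Y ℝ} (hγ : NonnegCoeffs γ) (n k δ s : ℕ) (hs : max k δ < s) :
    TotallyPositive (toeplitz fun i =>
      pathMatrix t ℓ (fun _ => a) (fun _ => yPoly ℓ γ) (n + δ * i) (k + s * i)) := by
  rw [pathMatrix_eq_riordan, stepSeries_eq t ha]
  have hgTP := totallyPositive_seriesToeplitz_invOfUnit (ℓ := ℓ) hγ
  set g := PowerSeries.invOfUnit (1 - PowerSeries.C (yPoly ℓ γ) * PowerSeries.X) 1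
  set Q := factorSeries ℓ Y
  have hQTP : TotallyPositive (seriesToeplitz Q) := totallyPositive_factorSeries
  -- `s > k` leaves a factor `Q (Q g)^u` for `χ` once `φ = g (Q g)^k` is split off; `s > δ` and `t ≥
  -- 1` make the power `z^e` in `χ` have a nonnegative exponent.
  obtain ⟨u, rfl⟩ : ∃ u, s = k + u + 1 := ⟨s - k - 1, by
    have := (le_max_left k δ).trans_lt hs; omega⟩
  obtain ⟨e, he⟩ : ∃ e, t * (k + u + 1) = δ + e := Nat.exists_eq_add_of_le (by
    have := (le_max_right k δ).trans_lt hs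
    nlinarith)
  set φ := g * (Q * g) ^ k with hφ
  set χ := PowerSeries.X ^ e * (Q * (Q * g) ^ u) with hχ
  have hφTP : TotallyPositive (seriesToeplitz φ) :=
    hgTP.seriesToeplitz_mul ((hQTP.seriesToeplitz_mul hgTP).seriesToeplitz_pow k)
  have hχTP : TotallyPositive (seriesToeplitz χ) :=
    (totallyPositive_seriesToeplitz_X.seriesToeplitz_pow e).seriesToeplitz_mul
      (hQTP.seriesToeplitz_mul ((hQTP.seriesToeplitz_mul hgTP).seriesToeplitz_pow u))
  have key : ∀ i, g * (PowerSeries.X ^ t * Q * g) ^ (k + (k + u + 1) * i) =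
      PowerSeries.X ^ (t * k + δ * i) * (φ * (φ * χ) ^ i) := by
    intro i
    have h1 : (PowerSeries.X ^ t : PowerSeries (WeightRing ℓ Y)) ^ (k + u + 1) =
        PowerSeries.X ^ δ * PowerSeries.X ^ e := by
      rw [← pow_mul, he, pow_add]
    have h2 : (PowerSeries.X ^ t * Q * g) ^ (k + u + 1) = PowerSeries.X ^ δ * (φ * χ) := by
      rw [mul_assoc, mul_pow, h1, hφ, hχ]
      ring
    rw [pow_add, pow_mul _ (k + u + 1) i, h2, hφ]
    ring
  simp only [riordan, Matrix.of_apply, key, PowerSeries.coeff_X_pow_mul']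
  rcases le_or_gt (t * k) n with h | h
  · have : ∀ i, t * k + δ * i ≤ n + δ * i ∧ n + δ * i - (t * k + δ * i) = n - t * k :=
      fun i => by omega
    simp only [this, if_true]
    exact totallyPositive_toeplitz_coeff_mul_pow hφTP hχTP _
  -- Here `n < t k`, so the whole sequence is zero.
  · have : ∀ i, ¬ t * k + δ * i ≤ n + δ * i := fun i => by omega
    simp only [this, if_false]
    exact totallyPositive_toeplitz_zero

theorem totallyPositive_toeplitz_column {a : Fin (ℓ + 1) → WeightRing ℓ Y}
    (ha : ∑ i : Fin (ℓ + 1), Polynomial.C (a i) * Polynomial.X ^ (i : ℕ) =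
      ∏ j : Fin ℓ, (Polynomial.C (alphaVar Y j) * Polynomial.X + Polynomial.C (betaVar Y j)))
    {γ : MvPolynomial Y ℝ} (hγ : NonnegCoeffs γ) (k : ℕ) :
    TotallyPositive (toeplitz fun n =>
      pathMatrix t ℓ (fun _ => a) (fun _ => yPoly ℓ γ) n k) := by
  rw [pathMatrix_eq_riordan]
  have hg := totallyPositive_seriesToeplitz_invOfUnit (ℓ := ℓ) hγ
  exact hg.seriesToeplitz_mul
    (((totallyPositive_stepSeries t ha).seriesToeplitz_mul hg).seriesToeplitz_pow k)

theorem factorSeries_pow (k : ℕ) : factorSeries ℓ Y ^ k =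
    ∑ c ∈ Fintype.piFinset fun _ : Fin ℓ => Finset.range (k + 1),
      PowerSeries.C (∏ j : Fin ℓ, ((k.choose (c j) : WeightRing ℓ Y) *
        alphaVar Y j ^ c j * betaVar Y j ^ (k - c j))) * PowerSeries.X ^ (∑ j, c j) := by
  have h : ∀ j : Fin ℓ, (PowerSeries.C (alphaVar Y j) * PowerSeries.X +
      PowerSeries.C (betaVar Y j)) ^ k = ∑ m ∈ Finset.range (k + 1),
      PowerSeries.C ((k.choose m : WeightRing ℓ Y) *
        alphaVar Y j ^ m * betaVar Y j ^ (k - m)) * PowerSeries.X ^ m := by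
    intro j
    rw [add_pow]
    refine Finset.sum_congr rfl fun m _ => ?_
    simp only [map_mul, map_pow, map_natCast]
    ring
  rw [factorSeries, ← Finset.prod_pow]
  simp only [h]
  rw [Finset.prod_univ_sum]
  refine Finset.sum_congr rfl fun c _ => ?_
  rw [Finset.prod_mul_distrib, Finset.prod_pow_eq_pow_sum, map_prod]

/-- Column `k` is `z^(t k) Q^k g^(k + 1)` with `Q` the product of the linear factors: the binomial
theorem expands `Q^k`, and `g^(k + 1)` has coefficients `(k + i).choose i * γ ^ i`. The integer
condition makes the sum empty when `n < t k`. -/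
theorem pathMatrix_apply {a : Fin (ℓ + 1) → WeightRing ℓ Y}
    (ha : ∑ i : Fin (ℓ + 1), Polynomial.C (a i) * Polynomial.X ^ (i : ℕ) =
      ∏ j : Fin ℓ, (Polynomial.C (alphaVar Y j) * Polynomial.X + Polynomial.C (betaVar Y j)))
    (γ : WeightRing ℓ Y) (n k : ℕ) :
    pathMatrix t ℓ (fun _ => a) (fun _ => γ) n k =
      ∑ i ∈ Finset.range (n + 1),
        ∑ c ∈ Fintype.piFinset (fun _ : Fin ℓ => Finset.range (k + 1)) with
            (i : ℤ) + ∑ j : Fin ℓ, (c j : ℤ) = (n : ℤ) - (t : ℤ) * (k : ℤ),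
          ((k + i).choose i : WeightRing ℓ Y) * γ ^ i *
            ∏ j : Fin ℓ, ((k.choose (c j) : WeightRing ℓ Y) *
              alphaVar Y j ^ c j * betaVar Y j ^ (k - c j)) := by
  rw [pathMatrix_eq_riordan, stepSeries_eq t ha, riordan, Matrix.of_apply]
  set g := PowerSeries.invOfUnit (1 - PowerSeries.C γ * PowerSeries.X) 1 with hg
  have h : g * (PowerSeries.X ^ t * factorSeries ℓ Y * g) ^ k =
      factorSeries ℓ Y ^ k * (PowerSeries.X ^ (t * k) * g ^ (k + 1)) := by
    rw [pow_mul]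
    ring
  rw [h, factorSeries_pow, Finset.sum_mul, map_sum]
  simp only [Finset.sum_filter]
  rw [Finset.sum_comm]
  refine Finset.sum_congr rfl fun c _ => ?_
  rw [mul_assoc, ← mul_assoc (PowerSeries.X ^ _), ← pow_add, PowerSeries.coeff_C_mul,
    PowerSeries.coeff_X_pow_mul', hg]
  have hcond : ∀ i : ℕ, ((i : ℤ) + ∑ j : Fin ℓ, (c j : ℤ) = (n : ℤ) - (t : ℤ) * (k : ℤ)) ↔
      i + (∑ j, c j + t * k) = n := by
    intro i
    have : (∑ j : Fin ℓ, (c j : ℤ)) = ((∑ j, c j : ℕ) : ℤ) := by push_cast; rfl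
    rw [this, ← Nat.cast_mul]
    omega
  simp only [hcond]
  split_ifs with hle
  -- For fixed `c` the degree condition leaves a single `i`.
  · rw [Finset.sum_eq_single (n - (∑ j, c j + t * k)), if_pos (by omega),
      coeff_invOfUnit_one_sub_pow]
    · ring
    · intro i _ hi
      rw [if_neg (by omega)]
    · intro hn
      rw [Finset.mem_range] at hn
      omega
  · rw [mul_zero, Finset.sum_eq_zero]
    intro i _
    rw [if_neg (by omega)]

end

/-! ### The theorem. -/

theorem theorem1p8 (t ℓ : ℕ) {Y : Type*}
    (a : ℕ → Fin (ℓ + 1) → WeightRing ℓ Y) (b : ℕ → MvPolynomial Y ℝ)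
    (hb : ∀ n, NonnegCoeffs (b n))
    (ha : ∀ n, ∑ i : Fin (ℓ + 1), Polynomial.C (a n i) * Polynomial.X ^ (i : ℕ) =
      ∏ j : Fin ℓ, (Polynomial.C (alphaVar Y j) * Polynomial.X + Polynomial.C (betaVar Y j)))
    (M : Matrix ℕ ℕ (WeightRing ℓ Y)) (hM : M = pathMatrix t ℓ a (fun n => yPoly ℓ (b n))) :
    -- (i)
    (TotallyPositive M ∧
      (1 ≤ t → ∀ n : ℕ, TotallyPositive (toeplitz fun k => M n k))) ∧
    ∀ γ : MvPolynomial Y ℝ, (∀ n, b n = γ) →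
      -- (ii)
      (∀ k : ℕ, TotallyPositive (toeplitz fun n => M n k)) ∧
      -- (iii)
      (1 ≤ t → ∀ n k δ σ : ℕ, k ≤ n → 0 < δ → max k δ < σ →
        TotallyPositive (toeplitz fun i => M (n + δ * i) (k + σ * i))) ∧
      -- (iv)
      (∀ m : ℕ, M = riordan
        (PowerSeries.invOfUnit (1 - PowerSeries.C (yPoly ℓ γ) * PowerSeries.X) 1)
        ((∑ i : Fin (ℓ + 1), PowerSeries.C (a m i) * PowerSeries.X ^ (t + (i : ℕ))) *
          PowerSeries.invOfUnit (1 - PowerSeries.C (yPoly ℓ γ) * PowerSeries.X) 1)) ∧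
      -- (v)
      (∀ n k : ℕ, M n k =
        ∑ i ∈ Finset.range (n + 1),
          ∑ c ∈ Fintype.piFinset (fun _ : Fin ℓ => Finset.range (k + 1)) with
              (i : ℤ) + ∑ j : Fin ℓ, (c j : ℤ) = (n : ℤ) - (t : ℤ) * (k : ℤ),
            ((k + i).choose i : WeightRing ℓ Y) * yPoly ℓ γ ^ i *
              ∏ j : Fin ℓ, ((k.choose (c j) : WeightRing ℓ Y) *
                alphaVar Y j ^ c j * betaVar Y j ^ (k - c j))) ∧
      -- (vi)
      (∀ m : ℕ, bivariateGF M =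
        MvPowerSeries.invOfUnit
          (1 - MvPowerSeries.C (yPoly ℓ γ) * MvPowerSeries.X 1 -
            MvPowerSeries.X 0 *
              ∑ i : Fin (ℓ + 1), MvPowerSeries.C (a m i) * MvPowerSeries.X 1 ^ (t + (i : ℕ))) 1) := by
  -- Comparing coefficients of the product shows that the weights do not depend on the height.
  obtain ⟨a, rfl⟩ : ∃ a', a = fun _ => a' :=
    ⟨a 0, funext fun n => eq_of_sum_C_mul_X_pow_eq ((ha n).trans (ha 0).symm)⟩
  have ha := ha 0
  subst hM
  have hL := totallyPositive_verticalMatrix fun n => (hb n).yPoly (ℓ := ℓ)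
  have hH := totallyPositive_stepSeries t ha
  have hrec := pathMatrix_eq_lowerMul (t := t) a fun n => yPoly ℓ (b n)
  refine ⟨⟨?_, fun _ n => ?_⟩, fun γ hγ => ?_⟩
  · exact totallyPositive_of_eq_lowerMul_consCol hL (lowerTriangular_verticalMatrix _) hH
      (lowerTriangular_toeplitz _) hrec
  · exact totallyPositive_toeplitz_row hL (lowerTriangular_verticalMatrix _) hH
      (lowerTriangular_toeplitz _) hrec n
  · have hγ' : NonnegCoeffs γ := hγ 0 ▸ hb 0
    simp only [hγ]
    exact ⟨totallyPositive_toeplitz_column ha hγ',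
      fun ht n k δ s _ _ hs => totallyPositive_toeplitz_line ht ha hγ' n k δ s hs,
      fun _ => pathMatrix_eq_riordan a _, pathMatrix_apply ha _,
      fun _ => bivariateGF_pathMatrix a _⟩
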